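/- Let $p$ be a prime. For a pro-$p$ group $\Delta$ let $\Delta^{(n)}$ denote its descending $p$-central series: $\Delta^{(1)}=\Delta$, and $\Delta^{(n+1)}$ is the closed subgroup generated by the $p$-th powers of elements of $\Delta^{(n)}$ and the commutators $[\Delta^{(n)},\Delta]$. Let $H^2(\Delta,\mathbb{F}_p)^{\mathrm{dec}}\subseteq H^2(\Delta,\mathbb{F}_p)$ denote the subgroup of continuous cohomology generated by the cup products of elements of $H^1(\Delta,\mathbb{F}_p)$. Let $\Gamma$ and $H$ be pro-$p$ groups with maximal closed subgroups $\Delta$ and $N$, respectively (that is, maximal among the proper closed subgroups; they are automatically normal), and let $\alpha\colon\Gamma\to H$ be a continuous surjective homomorphism with $\alpha(\Delta)=N$ and $\ker\alpha\subseteq\Delta^{(3)}$. Write $G=\Gamma/\Delta$, which $\alpha$ identifies with $H/N$. Then $H^2(\Delta,\mathbb{F}_p)^{\mathrm{dec}}\cong H^2(N,\mathbb{F}_p)^{\mathrm{dec}}$ as $\mathbb{F}_pG$-modules, where $\Gamma/\Delta$ and $H/N$ act on the cohomology of $\Delta$ and $N$ by conjugation. -/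

import Mathlib

universe u

namespace ModPCohomology

open CategoryTheory TopRep

/-- The discrete coefficient module `𝔽_p`, placed in the universe of the group. -/
abbrev Fp (p : ℕ) : Type u := ULift.{u} (ZMod p)

instance (p : ℕ) : ContinuousSMul (ZMod p) (Fp.{u} p) :=
  ⟨continuous_of_discreteTopology⟩

/-- `𝔽_p` with the trivial action of `G`. -/
noncomputable abbrev triv (p : ℕ) (G : Type u) [Group G] : TopRep.{u} (ZMod p) G :=
  TopRep.of (ContRepresentation.trivial (ZMod p) G (Fp.{u} p))

section Group

variable (p : ℕ) (G : Type u) [Group G] [TopologicalSpace G] [IsTopologicalGroup G]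

/-- The complex of homogeneous continuous cochains of `G` with coefficients in `𝔽_p`. -/
noncomputable abbrev cochains : CochainComplex (TopModuleCat.{u} (ZMod p)) ℕ :=
  homogeneousCochains (triv p G)

/-- Continuous cohomology `H^n(G, 𝔽_p)`. -/
noncomputable abbrev H (n : ℕ) : TopModuleCat.{u} (ZMod p) :=
  continuousCohomology n (triv p G)

/-- Homogeneous continuous `n`-cocycles with values in `𝔽_p`. -/
noncomputable abbrev Z (n : ℕ) : TopModuleCat.{u} (ZMod p) :=
  ContinuousCohomology.cocycles (triv p G) n

variable {p G}

/-- The function of two variables underlying a homogeneous 1-cochain. -/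
def val₁ (f : (cochains p G).X 1) : C(G, C(G, Fp.{u} p)) := f.1

/-- The function of three variables underlying a homogeneous 2-cochain. -/
def val₂ (f : (cochains p G).X 2) : C(G, C(G, C(G, Fp.{u} p))) := f.1

theorem val₁_inv (f : (cochains p G).X 1) (g x y : G) :
    val₁ f (g * x) (g * y) = val₁ f x y := by
  have h := congr($(f.2 g⁻¹) x y)
  change val₁ f (g⁻¹⁻¹ * x) (g⁻¹⁻¹ * y) = val₁ f x y at h
  rwa [inv_inv] at h

theorem val₂_inv (f : (cochains p G).X 2) (g x y z : G) :
    val₂ f (g * x) (g * y) (g * z) = val₂ f x y z := by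
  have h := congr($(f.2 g⁻¹) x y z)
  change val₂ f (g⁻¹⁻¹ * x) (g⁻¹⁻¹ * y) (g⁻¹⁻¹ * z) = val₂ f x y z at h
  rwa [inv_inv] at h

theorem ext₂ {f f' : (cochains p G).X 2} (h : ∀ x y z, val₂ f x y z = val₂ f' x y z) :
    f = f' :=
  Subtype.ext (ContinuousMap.ext fun x => ContinuousMap.ext fun y => ContinuousMap.ext (h x y))

theorem val₂_add (f f' : (cochains p G).X 2) (x y z : G) :
    val₂ (f + f') x y z = val₂ f x y z + val₂ f' x y z := rfl

theorem val₂_smul (c : ZMod p) (f : (cochains p G).X 2) (x y z : G) :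
    val₂ (c • f) x y z = c • val₂ f x y z := rfl

theorem val₂_sub (f f' : (cochains p G).X 2) (x y z : G) :
    val₂ (f - f') x y z = val₂ f x y z - val₂ f' x y z := rfl

/-- A homogeneous 1-cochain from an invariant continuous function of two variables. -/
noncomputable def mk₁ (f : G → G → Fp.{u} p) (hf : Continuous fun x : G × G => f x.1 x.2)
    (hinv : ∀ g x y, f (g * x) (g * y) = f x y) : (cochains p G).X 1 :=
  ⟨ContinuousMap.curry ⟨fun x : G × G => f x.1 x.2, hf⟩, fun g =>
    ContinuousMap.ext fun x => ContinuousMap.ext fun y => hinv g⁻¹ x y⟩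

/-- A homogeneous 2-cochain from an invariant continuous function of three variables. -/
noncomputable def mk₂ (f : G → G → G → Fp.{u} p) (hf : Continuous fun x : (G × G) × G => f x.1.1 x.1.2 x.2)
    (hinv : ∀ g x y z, f (g * x) (g * y) (g * z) = f x y z) : (cochains p G).X 2 :=
  ⟨ContinuousMap.curry (ContinuousMap.curry ⟨fun x : (G × G) × G => f x.1.1 x.1.2 x.2, hf⟩),
    fun g => ContinuousMap.ext fun x => ContinuousMap.ext fun y => ContinuousMap.ext fun z =>
      hinv g⁻¹ x y z⟩

theorem d₀_apply (f : (cochains p G).X 0) : ((cochains p G).d 0 1).hom f = 0 := by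
  apply Subtype.ext
  rw [homogeneousCochains.d_apply]
  refine ContinuousMap.ext fun x => ContinuousMap.ext fun y => ?_
  have h : (f.1 : C(G, Fp.{u} p)) (x⁻¹⁻¹ * 1) = (f.1 : C(G, Fp.{u} p)) 1 := congr($(f.2 x⁻¹) 1)
  have h' : (f.1 : C(G, Fp.{u} p)) (y⁻¹⁻¹ * 1) = (f.1 : C(G, Fp.{u} p)) 1 := congr($(f.2 y⁻¹) 1)
  simp only [inv_inv, mul_one] at h h'
  change (f.1 : C(G, Fp.{u} p)) y - (f.1 : C(G, Fp.{u} p)) x = 0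
  rw [h, h', sub_self]

theorem d₁_apply (f : (cochains p G).X 1) (x y z : G) :
    val₂ (((cochains p G).d 1 2).hom f) x y z =
      val₁ f y z - (val₁ f x z - val₁ f x y) := by
  unfold val₂
  rw [homogeneousCochains.d_apply]
  rfl

theorem d₂_apply (f : (cochains p G).X 2) (x y z w : G) :
    (show C(G, C(G, C(G, C(G, Fp.{u} p)))) from (((cochains p G).d 2 3).hom f).1) x y z w =
      val₂ f y z w - (val₂ f x z w - (val₂ f x y w - val₂ f x y z)) := by
  rw [homogeneousCochains.d_apply]
  rfl

/-- The cocycle determined by a cochain with vanishing differential. -/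
noncomputable def mkZ {n : ℕ} (f : (cochains p G).X n)
    (hf : ((cochains p G).d n (n + 1)).hom f = 0) : Z p G n :=
  ((cochains p G).liftCycles (TopModuleCat.kerι ((cochains p G).d n (n + 1))) (n + 1) (by simp)
    (TopModuleCat.kerι_comp _)).hom ⟨f, hf⟩

/-- The cochain underlying a cocycle. -/
noncomputable def cochain {n : ℕ} (z : Z p G n) : (cochains p G).X n :=
  ((cochains p G).iCycles n).hom z

theorem cochain_mkZ {n : ℕ} (f : (cochains p G).X n)
    (hf : ((cochains p G).d n (n + 1)).hom f = 0) : cochain (mkZ f hf) = f :=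
  ConcreteCategory.congr_hom ((cochains p G).liftCycles_i
    (TopModuleCat.kerι ((cochains p G).d n (n + 1))) (n + 1) (by simp)
    (TopModuleCat.kerι_comp _)) (⟨f, hf⟩ : TopModuleCat.ker ((cochains p G).d n (n + 1)))

theorem d_cochain {n : ℕ} (z : Z p G n) :
    ((cochains p G).d n (n + 1)).hom (cochain z) = 0 :=
  ConcreteCategory.congr_hom ((cochains p G).iCycles_d n (n + 1)) z

theorem cochain_injective {n : ℕ} :
    Function.Injective (cochain : Z p G n → (cochains p G).X n) := by
  let e := ((cochains p G).cyclesIsKernel n (n + 1) (by simp)).conePointUniqueUpToIso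
    (TopModuleCat.isLimitKer ((cochains p G).d n (n + 1)))
  have he : e.hom ≫ TopModuleCat.kerι _ = (cochains p G).iCycles n :=
    ((cochains p G).cyclesIsKernel n (n + 1) (by simp)).conePointUniqueUpToIso_hom_comp
      (TopModuleCat.isLimitKer ((cochains p G).d n (n + 1))) Limits.WalkingParallelPair.zero
  intro z z' h
  have h1 : (TopModuleCat.kerι ((cochains p G).d n (n + 1))).hom (e.hom.hom z) =
      (TopModuleCat.kerι ((cochains p G).d n (n + 1))).hom (e.hom.hom z') := by
    have a := ConcreteCategory.congr_hom he z
    have b := ConcreteCategory.congr_hom he z'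
    exact a.trans (h.trans b.symm)
  have h2 := Subtype.val_injective h1
  have h3 : ∀ w, e.inv.hom (e.hom.hom w) = w := fun w =>
    ConcreteCategory.congr_hom e.hom_inv_id w
  rw [← h3 z, ← h3 z', h2]

theorem cochain_add {n : ℕ} (z z' : Z p G n) : cochain (z + z') = cochain z + cochain z' :=
  map_add ((cochains p G).iCycles n).hom z z'

theorem cochain_smul {n : ℕ} (c : ZMod p) (z : Z p G n) : cochain (c • z) = c • cochain z :=
  map_smul ((cochains p G).iCycles n).hom c z

theorem cochain_sub {n : ℕ} (z z' : Z p G n) : cochain (z - z') = cochain z - cochain z' :=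
  map_sub ((cochains p G).iCycles n).hom z z'

theorem cocycle₁ (z : Z p G 1) (x y w : G) :
    val₁ (cochain z) x w = val₁ (cochain z) x y + val₁ (cochain z) y w := by
  have h := d₁_apply (cochain z) x y w
  rw [d_cochain] at h
  change (0 : Fp.{u} p) = _ at h
  linear_combination h

theorem cocycle₂ (z : Z p G 2) (x y w v : G) :
    val₂ (cochain z) y w v - val₂ (cochain z) x w v + val₂ (cochain z) x y v
      - val₂ (cochain z) x y w = 0 := by
  have h := d₂_apply (cochain z) x y w v
  rw [d_cochain] at h
  change (0 : Fp.{u} p) = _ at h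
  linear_combination -h

/-- The cohomology class of a cocycle. -/
noncomputable def cls (n : ℕ) : Z p G n →ₗ[ZMod p] H p G n :=
  (ContinuousCohomology.π (triv p G) n).hom.toLinearMap

theorem cls_eq_zero {n : ℕ} (z : Z p G (n + 1)) (f : (cochains p G).X n)
    (h : cochain z = ((cochains p G).d n (n + 1)).hom f) : cls (n + 1) z = 0 := by
  have hz : z = ((cochains p G).toCycles n (n + 1)).hom f := by
    apply cochain_injective
    rw [h]
    exact (ConcreteCategory.congr_hom ((cochains p G).toCycles_i n (n + 1)) f).symm
  rw [hz]
  exact ConcreteCategory.congr_hom ((cochains p G).toCycles_comp_homologyπ n (n + 1)) f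

instance : IsIso (ContinuousCohomology.π (triv p G) 1) :=
  (cochains p G).isIso_homologyπ 0 1 (by simp) (by ext f; exact d₀_apply f)

/-- With trivial coefficients there are no nonzero 1-coboundaries, so a class in `H^1` has exactly
one representing cocycle. -/
noncomputable def rep₁ : H p G 1 →ₗ[ZMod p] Z p G 1 :=
  (inv (ContinuousCohomology.π (triv p G) 1)).hom.toLinearMap

theorem cls_rep₁ (a : H p G 1) : cls 1 (rep₁ a) = a :=
  ConcreteCategory.congr_hom (IsIso.inv_hom_id (ContinuousCohomology.π (triv p G) 1)) a

theorem rep₁_cls (z : Z p G 1) : rep₁ (cls 1 z) = z :=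
  ConcreteCategory.congr_hom (IsIso.hom_inv_id (ContinuousCohomology.π (triv p G) 1)) z

variable [CompactSpace G]

/-- The cup product of homogeneous 1-cocycles, as a cochain:
`(f ∪ f')(x, y, z) = f (x, y) * f' (y, z)`. -/
noncomputable def cupCochain (f f' : Z p G 1) : (cochains p G).X 2 :=
  mk₂ (fun x y z => val₁ (cochain f) x y * val₁ (cochain f') y z) (by fun_prop)
    (fun g x y z => by rw [val₁_inv, val₁_inv])

theorem d_cupCochain (f f' : Z p G 1) :
    ((cochains p G).d 2 3).hom (cupCochain f f') = 0 := by
  apply Subtype.ext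
  refine ContinuousMap.ext fun x => ContinuousMap.ext fun y => ContinuousMap.ext fun z =>
    ContinuousMap.ext fun w => ?_
  refine (d₂_apply _ x y z w).trans ?_
  change val₁ (cochain f) y z * val₁ (cochain f') z w
    - (val₁ (cochain f) x z * val₁ (cochain f') z w
    - (val₁ (cochain f) x y * val₁ (cochain f') y w
    - val₁ (cochain f) x y * val₁ (cochain f') y z)) = 0
  rw [cocycle₁ f x y z, cocycle₁ f' y z w]
  ring

/-- The cup product of 1-cocycles, as a 2-cocycle. -/
noncomputable def cupZ (f f' : Z p G 1) : Z p G 2 :=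
  mkZ (cupCochain f f') (d_cupCochain f f')

theorem val₂_cupZ (f f' : Z p G 1) (x y z : G) :
    val₂ (cochain (cupZ f f')) x y z = val₁ (cochain f) x y * val₁ (cochain f') y z := by
  rw [cupZ, cochain_mkZ]
  rfl

/-- The cup product `H^1(G, 𝔽_p) × H^1(G, 𝔽_p) → H^2(G, 𝔽_p)`. -/
noncomputable def cup : H p G 1 →ₗ[ZMod p] H p G 1 →ₗ[ZMod p] H p G 2 :=
  LinearMap.mk₂ (ZMod p) (fun a b => cls 2 (cupZ (rep₁ a) (rep₁ b)))
    (fun a a' b => by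
      rw [← map_add]
      congr 1
      apply cochain_injective
      apply ext₂
      intro x y z
      rw [cochain_add]
      rw [val₂_add]
      rw [val₂_cupZ, val₂_cupZ, val₂_cupZ, map_add, cochain_add]
      exact add_mul _ _ _)
    (fun c a b => by
      rw [← map_smul]
      congr 1
      apply cochain_injective
      apply ext₂
      intro x y z
      rw [cochain_smul]
      rw [val₂_smul]
      rw [val₂_cupZ, val₂_cupZ, map_smul, cochain_smul]
      exact smul_mul_assoc c _ _)
    (fun a b b' => by
      rw [← map_add]
      congr 1
      apply cochain_injective
      apply ext₂
      intro x y z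
      rw [cochain_add]
      rw [val₂_add]
      rw [val₂_cupZ, val₂_cupZ, val₂_cupZ, map_add, cochain_add]
      exact mul_add _ _ _)
    (fun c a b => by
      rw [← map_smul]
      congr 1
      apply cochain_injective
      apply ext₂
      intro x y z
      rw [cochain_smul]
      rw [val₂_smul]
      rw [val₂_cupZ, val₂_cupZ, map_smul, cochain_smul]
      exact mul_smul_comm c _ _)

theorem cup_cls (f f' : Z p G 1) : cup (cls 1 f) (cls 1 f') = cls 2 (cupZ f f') := by
  change cls 2 (cupZ (rep₁ _) (rep₁ _)) = _
  rw [rep₁_cls, rep₁_cls]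

variable (p G) in
/-- The decomposable part `H^2(G, 𝔽_p)^{dec}`: the subgroup generated by the cup products of
elements of `H^1(G, 𝔽_p)`. -/
noncomputable def dec : Submodule (ZMod p) (H p G 2) :=
  Submodule.span (ZMod p) {c | ∃ a b : H p G 1, cup a b = c}

end Group

section Functoriality

variable {p : ℕ} {G G' G'' : Type u}
  [Group G] [TopologicalSpace G] [IsTopologicalGroup G]
  [Group G'] [TopologicalSpace G'] [IsTopologicalGroup G']
  [Group G''] [TopologicalSpace G''] [IsTopologicalGroup G'']

/-- The restriction of `𝔽_p` along a homomorphism is `𝔽_p`. -/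
noncomputable def trivRes (φ : G' →ₜ* G) : res (φ : G' →* G) (triv p G) ⟶ triv p G' :=
  ofHom ⟨ContinuousLinearMap.id (ZMod p) (Fp.{u} p), fun _ => rfl⟩

/-- The map `H^n(G, 𝔽_p) → H^n(G', 𝔽_p)` induced by a continuous homomorphism `G' → G`. -/
noncomputable def pull (φ : G' →ₜ* G) (n : ℕ) : H p G n →ₗ[ZMod p] H p G' n :=
  (ContinuousCohomology.map φ (trivRes φ) n).hom.toLinearMap

/-- The map on cocycles induced by a continuous homomorphism. -/
noncomputable def pullZ (φ : G' →ₜ* G) (n : ℕ) : Z p G n →ₗ[ZMod p] Z p G' n :=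
  (ContinuousCohomology.cocyclesMap φ (trivRes φ) n).hom.toLinearMap

theorem pull_id (n : ℕ) : pull (p := p) (ContinuousMonoidHom.id G) n = LinearMap.id := by
  have h := ContinuousCohomology.map_id (triv p G) n
  ext x
  exact ConcreteCategory.congr_hom h x

theorem pull_comp (φ : G' →ₜ* G) (ψ : G'' →ₜ* G') (n : ℕ) :
    pull (p := p) (φ.comp ψ) n = (pull ψ n).comp (pull φ n) := by
  have h := ContinuousCohomology.map_comp φ ψ (trivRes (p := p) φ) (trivRes ψ) n
  ext x
  exact ConcreteCategory.congr_hom h x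

theorem pull_cls (φ : G' →ₜ* G) (n : ℕ) (z : Z p G n) :
    pull φ n (cls n z) = cls n (pullZ φ n z) :=
  ConcreteCategory.congr_hom (ContinuousCohomology.π_map φ (trivRes (p := p) φ) n) z

set_option maxHeartbeats 1000000 in
theorem cochain_pullZ (φ : G' →ₜ* G) (n : ℕ) (z : Z p G n) :
    cochain (pullZ φ n z) =
      ((ContinuousCohomology.cochainsMap φ (trivRes (p := p) φ)).f n).hom (cochain z) :=
  ConcreteCategory.congr_hom (HomologicalComplex.cyclesMap_i
    (ContinuousCohomology.cochainsMap φ (trivRes (p := p) φ)) n) z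

theorem val₁_pullZ (φ : G' →ₜ* G) (z : Z p G 1) (x y : G') :
    val₁ (cochain (pullZ φ 1 z)) x y = val₁ (cochain z) (φ x) (φ y) := by
  rw [cochain_pullZ]
  rfl

theorem val₂_pullZ (φ : G' →ₜ* G) (z : Z p G 2) (x y w : G') :
    val₂ (cochain (pullZ φ 2 z)) x y w = val₂ (cochain z) (φ x) (φ y) (φ w) := by
  rw [cochain_pullZ]
  rfl

variable [CompactSpace G] [CompactSpace G']

theorem pull_cup (φ : G' →ₜ* G) (a b : H p G 1) :
    pull φ 2 (cup a b) = cup (pull φ 1 a) (pull φ 1 b) := by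
  rw [← cls_rep₁ a, ← cls_rep₁ b, cup_cls, pull_cls, pull_cls, pull_cls, cup_cls]
  congr 1
  apply cochain_injective
  apply ext₂
  intro x y z
  rw [val₂_pullZ, val₂_cupZ, val₂_cupZ, val₁_pullZ, val₁_pullZ]

theorem dec_le_comap_pull (φ : G' →ₜ* G) : dec p G ≤ (dec p G').comap (pull φ 2) := by
  refine Submodule.span_le.2 ?_
  rintro _ ⟨a, b, rfl⟩
  exact Submodule.subset_span ⟨pull φ 1 a, pull φ 1 b, (pull_cup φ a b).symm⟩

/-- Inner automorphisms act trivially on `H^2`. -/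
theorem pull_inner (φ : G →ₜ* G) (d : G) (hφ : ∀ x, φ x = d⁻¹ * x * d) (c : H p G 2) :
    pull φ 2 c = c := by
  have key : ∀ z : Z p G 2, cls 2 (pullZ φ 2 z - z) = 0 := by
    intro z
    let f := val₂ (cochain z)
    refine cls_eq_zero _ (mk₁ (fun x y => f x (x * d) (y * d) - f x y (y * d)) (by fun_prop) ?_) ?_
    · intro g x y
      simp only [mul_assoc, f, val₂_inv]
    · apply ext₂
      intro x y w
      rw [cochain_sub, d₁_apply]
      change val₂ (cochain (pullZ φ 2 z)) x y w - f x y w = (f y (y * d) (w * d) - f y w (w * d))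
        - ((f x (x * d) (w * d) - f x w (w * d)) - (f x (x * d) (y * d) - f x y (y * d)))
      rw [val₂_pullZ, hφ, hφ, hφ, mul_assoc, mul_assoc, mul_assoc, val₂_inv]
      have h1 := cocycle₂ z x (x * d) (y * d) (w * d)
      have h2 := cocycle₂ z x y (y * d) (w * d)
      have h3 := cocycle₂ z x y w (w * d)
      linear_combination h1 - h2 + h3
  have h : ContinuousCohomology.π (triv p G) 2 ≫ ContinuousCohomology.map φ (trivRes (p := p) φ) 2 =
      ContinuousCohomology.π (triv p G) 2 := by
    ext z
    have h0 := key z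
    rw [map_sub, sub_eq_zero, ← pull_cls] at h0
    exact h0
  have h' : ContinuousCohomology.map φ (trivRes (p := p) φ) 2 = 𝟙 _ := by
    rw [← cancel_epi (ContinuousCohomology.π (triv p G) 2), h, Category.comp_id]
  exact ConcreteCategory.congr_hom h' c

end Functoriality

section Action

variable (p : ℕ) {Γ : Type u} [Group Γ] [TopologicalSpace Γ] [IsTopologicalGroup Γ]
  (Δ : Subgroup Γ) [Δ.Normal]

variable {p} in
/-- The automorphism `x ↦ g⁻¹ x g` of the normal subgroup `Δ`. -/
def conjInv (g : Γ) : Δ →ₜ* Δ where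
  toMonoidHom := (MulAut.conjNormal g⁻¹ : Δ ≃* Δ).toMonoidHom
  continuous_toFun := by
    refine continuous_induced_rng.2 ?_
    change Continuous fun x : Δ => g⁻¹ * (x : Γ) * g⁻¹⁻¹
    fun_prop

theorem coe_conjInv (g : Γ) (x : Δ) : (conjInv Δ g x : Γ) = g⁻¹ * x * g := by
  change g⁻¹ * (x : Γ) * g⁻¹⁻¹ = _
  rw [inv_inv]

/-- The action of `Γ` on `H^2(Δ, 𝔽_p)` induced by conjugation: on homogeneous cochains
`(g · f)(x, y, z) = f (g⁻¹ x g, g⁻¹ y g, g⁻¹ z g)`. -/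
noncomputable def conjRep : Representation (ZMod p) Γ (H p Δ 2) where
  toFun g := pull (conjInv Δ g) 2
  map_one' := by
    have h : conjInv Δ (1 : Γ) = ContinuousMonoidHom.id Δ := by
      ext x
      simp [coe_conjInv]
    rw [h, pull_id]
    rfl
  map_mul' g g' := by
    have h : conjInv Δ (g * g') = (conjInv Δ g').comp (conjInv Δ g) := by
      ext x
      rw [coe_conjInv]
      change _ = (conjInv Δ g' (conjInv Δ g x) : Γ)
      rw [coe_conjInv, coe_conjInv]
      group
    rw [h, pull_comp]
    rfl

variable [CompactSpace Δ]

/-- The action of `Γ` on the decomposable part of `H^2(Δ, 𝔽_p)`. -/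
noncomputable def conjRepDec : Representation (ZMod p) Γ (dec p Δ) :=
  (conjRep p Δ).subrepresentation (dec p Δ) fun g => dec_le_comap_pull (conjInv Δ g)

instance : Representation.IsTrivial ((conjRepDec p Δ).comp Δ.subtype) where
  out d := by
    ext c
    refine pull_inner (conjInv Δ (d : Γ)) d (fun x => ?_) c.1
    ext
    simp [coe_conjInv]

/-- `H^2(Δ, 𝔽_p)^{dec}` as an `𝔽_p[Γ/Δ]`-module. -/
noncomputable def decRep : Representation (ZMod p) (Γ ⧸ Δ) (dec p Δ) :=
  (conjRepDec p Δ).ofQuotient Δ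

end Action

end ModPCohomology

section ProP

variable (p : ℕ) (Γ : Type*) [Group Γ] [TopologicalSpace Γ]

/-- A profinite group is pro-`p` if all its quotients by open normal subgroups are `p`-groups. -/
structure IsProP : Prop where
  compactSpace : CompactSpace Γ
  totallyDisconnectedSpace : TotallyDisconnectedSpace Γ
  isPGroup : ∀ U : OpenNormalSubgroup Γ, IsPGroup p (Γ ⧸ U.toSubgroup)

/-- The descending `p`-central series: `Γ^{(1)} = Γ`, and `Γ^{(n+1)}` is the closed subgroup
generated by the `p`-th powers of elements of `Γ^{(n)}` and the commutators `[Γ^{(n)}, Γ]`.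
(The index `0` is not used.) -/
def pCentralSeries [IsTopologicalGroup Γ] : ℕ → Subgroup Γ
  | 0 => ⊤
  | 1 => ⊤
  | n + 2 => (Subgroup.closure {x | ∃ y ∈ pCentralSeries (n + 1), y ^ p = x} ⊔
      ⁅pCentralSeries (n + 1), (⊤ : Subgroup Γ)⁆).topologicalClosure

variable {p Γ}

/-- A maximal closed subgroup: maximal among the proper closed subgroups. -/
structure IsMaximalClosed (Δ : Subgroup Γ) : Prop where
  isClosed : IsClosed (Δ : Set Γ)
  ne_top : Δ ≠ ⊤
  maximal : ∀ K : Subgroup Γ, IsClosed (K : Set Γ) → Δ ≤ K → K ≠ ⊤ → K = Δ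

theorem IsMaximalClosed.compactSpace {Δ : Subgroup Γ} (hΓ : IsProP p Γ)
    (hΔ : IsMaximalClosed Δ) : CompactSpace Δ :=
  have := hΓ.compactSpace
  isCompact_iff_compactSpace.1 hΔ.isClosed.isCompact

theorem IsMaximalClosed.normal [IsTopologicalGroup Γ] [Fact p.Prime] {Δ : Subgroup Γ}
    (hΓ : IsProP p Γ) (hΔ : IsMaximalClosed Δ) : Δ.Normal := by
  have := hΓ.compactSpace
  have := hΓ.totallyDisconnectedSpace
  -- `Δ` is open
  have hopen : IsOpen (Δ : Set Γ) := by
    have h := ProfiniteGrp.closedSubgroup_eq_sInf_open (⟨Δ, hΔ.isClosed⟩ : ClosedSubgroup Γ)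
    by_contra hno
    apply hΔ.ne_top
    change Δ = _ at h
    rw [h, sInf_eq_top]
    rintro K ⟨hK1, hK2⟩
    by_contra hK
    have := hΔ.maximal K (K.isClosed_of_isOpen hK1) hK2 hK
    exact hno (this ▸ hK1)
  have hfin : Finite (Γ ⧸ Δ) := Subgroup.quotient_finite_of_isOpen Δ hopen
  have hfi : Δ.FiniteIndex := Subgroup.finiteIndex_of_finite_quotient
  let U : OpenNormalSubgroup Γ :=
    { toSubgroup := Δ.normalCore
      isOpen' := Subgroup.isOpen_of_isClosed_of_finiteIndex _ (Δ.normalCore_isClosed hΔ.isClosed) }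
  let q : Γ →* Γ ⧸ U.toSubgroup := QuotientGroup.mk' U.toSubgroup
  have hq : Function.Surjective q := QuotientGroup.mk'_surjective _
  have hqk : q.ker ≤ Δ := (QuotientGroup.ker_mk' U.toSubgroup).le.trans Δ.normalCore_le
  have : Finite (Γ ⧸ U.toSubgroup) := Subgroup.quotient_finite_of_isOpen _ U.isOpen'
  have hnil : Group.IsNilpotent (Γ ⧸ U.toSubgroup) := (hΓ.isPGroup U).isNilpotent
  have hco : IsCoatom (Δ.map q) := by
    refine ⟨fun h => hΔ.ne_top ?_, fun K hK => ?_⟩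
    · rw [← Subgroup.comap_map_eq_self hqk, h, Subgroup.comap_top]
    · by_contra hne
      have hle : Δ ≤ K.comap q := Subgroup.map_le_iff_le_comap.1 hK.le
      have hop : IsOpen ((K.comap q : Subgroup Γ) : Set Γ) := Subgroup.isOpen_mono hle hopen
      have hne' : K.comap q ≠ ⊤ := fun h => hne (by
        rw [← Subgroup.map_comap_eq_self_of_surjective hq K, h,
          Subgroup.map_top_of_surjective q hq])
      have h := hΔ.maximal _ (Subgroup.isClosed_of_isOpen _ hop) hle hne'
      refine hK.not_ge ?_
      rw [← Subgroup.map_comap_eq_self_of_surjective hq K]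
      exact Subgroup.map_mono h.le
  have hn : (Δ.map q).Normal :=
    Subgroup.NormalizerCondition.normal_of_coatom _ Group.normalizerCondition_of_isNilpotent hco
  rw [← Subgroup.comap_map_eq_self hqk]
  exact hn.comap q

/-- The isomorphism `Γ/Δ ≃ H/N` induced by a surjection `α : Γ → H` with `α(Δ) = N` and
`ker α ⊆ Δ`. -/
noncomputable def quotientIso {Γ H : Type*} [Group Γ] [Group H] {Δ : Subgroup Γ} {N : Subgroup H}
    [Δ.Normal] [N.Normal] (α : Γ →* H) (hα : Function.Surjective α) (hN : Δ.map α = N)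
    (hker : α.ker ≤ Δ) : Γ ⧸ Δ ≃* H ⧸ N :=
  MulEquiv.ofBijective (QuotientGroup.map Δ N α (Subgroup.map_le_iff_le_comap.1 hN.le)) (by
    refine ⟨?_, QuotientGroup.map_surjective_of_surjective _ _ _
      ((QuotientGroup.mk'_surjective N).comp hα) _⟩
    rw [← MonoidHom.ker_eq_bot_iff, QuotientGroup.ker_map, ← hN,
      Subgroup.comap_map_eq_self hker, QuotientGroup.map_mk'_self])

end ProP

/-!
Inflation along `β : Δ → N`, the restriction of `α`, is the isomorphism. A continuous function
`Δ → 𝔽_p` that is additive as soon as one of its arguments lies in `Δ^{(n)}` vanishes on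
`Δ^{(n + 1)}`, hence factors through `β` as soon as `ker β ⊆ Δ^{(n + 1)}`; this is needed for
`n = 1` and `n = 2`.

For `n = 1` the functions in question are the homomorphisms, so inflation is onto in degree 1 and
therefore onto decomposable classes. For injectivity, represent a decomposable class of `N` by a
sum `z` of products of homomorphisms. Since homomorphisms vanish on `N^{(2)}`, so does `z` as soon
as one of its two (inhomogeneous) arguments lies in `N^{(2)}`. If the inflation of `z` is the
coboundary of `f`, then `f` is additive as soon as one of its arguments lies in `Δ^{(2)}`. The case
`n = 2` shows that `f` descends to `N`, where its coboundary is `z`.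
-/

section PCentralSeries

open scoped commutatorElement

variable {p : ℕ} {G G' : Type*} [Group G] [TopologicalSpace G] [IsTopologicalGroup G]
  [Group G'] [TopologicalSpace G'] [IsTopologicalGroup G']

theorem isClosed_pCentralSeries (n : ℕ) : IsClosed (pCentralSeries p G n : Set G) := by
  match n with
  | 0 | 1 => exact isClosed_univ
  | n + 2 => exact Subgroup.isClosed_topologicalClosure _

theorem pow_mem_pCentralSeries {n : ℕ} {x : G} (hx : x ∈ pCentralSeries p G (n + 1)) :
    x ^ p ∈ pCentralSeries p G (n + 2) :=
  Subgroup.le_topologicalClosure _ (Subgroup.mem_sup_left (Subgroup.subset_closure ⟨x, hx, rfl⟩))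

theorem commutatorElement_mem_pCentralSeries {n : ℕ} {x : G}
    (hx : x ∈ pCentralSeries p G (n + 1)) (y : G) : ⁅x, y⁆ ∈ pCentralSeries p G (n + 2) :=
  Subgroup.le_topologicalClosure _ (Subgroup.mem_sup_right
    (Subgroup.commutator_mem_commutator hx (Subgroup.mem_top y)))

theorem pCentralSeries_add_two_le {n : ℕ} {K : Subgroup G} (hK : IsClosed (K : Set G))
    (hpow : ∀ x ∈ pCentralSeries p G (n + 1), x ^ p ∈ K)
    (hcomm : ∀ x ∈ pCentralSeries p G (n + 1), ∀ y, ⁅x, y⁆ ∈ K) :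
    pCentralSeries p G (n + 2) ≤ K := by
  refine Subgroup.topologicalClosure_minimal _ (sup_le ?_ ?_) hK
  · rw [Subgroup.closure_le]
    rintro _ ⟨x, hx, rfl⟩
    exact hpow x hx
  · exact Subgroup.commutator_le.2 fun x hx y _ => hcomm x hx y

theorem pCentralSeries_antitone : Antitone (pCentralSeries p G) := by
  refine antitone_nat_of_succ_le fun n => ?_
  induction n with
  | zero => exact le_top
  | succ n ih =>
    cases n with
    | zero => exact le_top
    | succ n =>
      exact pCentralSeries_add_two_le (isClosed_pCentralSeries _)
        (fun x hx => pow_mem_pCentralSeries (ih hx))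
        (fun x hx y => commutatorElement_mem_pCentralSeries (ih hx) y)

theorem pCentralSeries_le_comap (φ : G →ₜ* G') (n : ℕ) :
    pCentralSeries p G n ≤ (pCentralSeries p G' n).comap (φ : G →* G') := by
  match n with
  | 0 | 1 => exact le_top
  | n + 2 =>
    refine pCentralSeries_add_two_le ((isClosed_pCentralSeries (n + 2)).preimage (map_continuous φ))
      (fun x hx => ?_) (fun x hx y => ?_)
    · rw [Subgroup.mem_comap, map_pow]
      exact pow_mem_pCentralSeries (pCentralSeries_le_comap φ (n + 1) hx)
    · rw [Subgroup.mem_comap, map_commutatorElement]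
      exact commutatorElement_mem_pCentralSeries (pCentralSeries_le_comap φ (n + 1) hx) _

end PCentralSeries

/-- A function `f : G → A` is additive along a subgroup `K` if `f (x * y) = f x + f y` as soon as
one of `x`, `y` lies in `K`. For `K = ⊤` these are the homomorphisms from `G` to `A`. -/
structure IsAdditiveAlong {G A : Type*} [Group G] [AddCommGroup A] (K : Subgroup G) (f : G → A) :
    Prop where
  map_mul_left : ∀ ⦃k⦄, k ∈ K → ∀ x, f (k * x) = f k + f x
  map_mul_right : ∀ ⦃k⦄, k ∈ K → ∀ x, f (x * k) = f x + f k

namespace IsAdditiveAlong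

open scoped commutatorElement

variable {G A : Type*} [Group G] [AddCommGroup A] {K : Subgroup G} {f : G → A}

theorem map_one (hf : IsAdditiveAlong K f) : f 1 = 0 := by
  simpa using hf.map_mul_left K.one_mem 1

theorem map_inv (hf : IsAdditiveAlong K f) {k : G} (hk : k ∈ K) : f k⁻¹ = -f k := by
  have h := hf.map_mul_left hk k⁻¹
  rw [mul_inv_cancel, hf.map_one] at h
  exact eq_neg_of_add_eq_zero_right h.symm

theorem map_pow (hf : IsAdditiveAlong K f) {k : G} (hk : k ∈ K) (n : ℕ) : f (k ^ n) = n • f k := by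
  induction n with
  | zero => rw [pow_zero, hf.map_one, zero_nsmul]
  | succ n ih => rw [pow_succ, hf.map_mul_right hk, ih, succ_nsmul]

theorem map_commutatorElement (hf : IsAdditiveAlong K f) {k x : G} (hk : k ∈ K)
    (hkx : ⁅k, x⁆ ∈ K) : f ⁅k, x⁆ = 0 := by
  have h : f k + f x = f ⁅k, x⁆ + (f k + f x) := calc
    f k + f x = f (⁅k, x⁆ * (x * k)) := by
      rw [← hf.map_mul_left hk, commutatorElement_def]
      group
    _ = f ⁅k, x⁆ + (f k + f x) := by
      rw [hf.map_mul_left hkx, hf.map_mul_right hk, add_comm (f x)]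
  exact right_eq_add.1 h

/-- The subgroup of the zeros of `f` in `K`, for `f` additive along `K`. -/
def ker (hf : IsAdditiveAlong K f) : Subgroup G where
  carrier := {k | k ∈ K ∧ f k = 0}
  one_mem' := ⟨K.one_mem, hf.map_one⟩
  mul_mem' ha hb := ⟨K.mul_mem ha.1 hb.1, by rw [hf.map_mul_left ha.1, ha.2, hb.2, add_zero]⟩
  inv_mem' ha := ⟨K.inv_mem ha.1, by rw [hf.map_inv ha.1, ha.2, neg_zero]⟩

theorem factorsThrough {G' : Type*} [Group G'] {φ : G →* G'} (hf : IsAdditiveAlong K f)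
    (hφ : φ.ker ≤ hf.ker) : Function.FactorsThrough f φ := by
  intro x y hxy
  obtain ⟨hmem, hzero⟩ := hφ (φ.eq_iff.1 hxy)
  rw [← mul_inv_cancel_left y x, hf.map_mul_right hmem, hzero, add_zero]

variable {p n : ℕ} [TopologicalSpace G] [IsTopologicalGroup G] [Module (ZMod p) A]
  [TopologicalSpace A] [T1Space A]

theorem pCentralSeries_le_ker (hf : IsAdditiveAlong (pCentralSeries p G (n + 1)) f)
    (hcont : Continuous f) : pCentralSeries p G (n + 2) ≤ hf.ker := by
  refine pCentralSeries_add_two_le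
    ((isClosed_pCentralSeries _).inter (isClosed_singleton.preimage hcont))
    (fun x hx => ⟨pow_mem hx p, ?_⟩) (fun x hx y => ?_)
  · rw [hf.map_pow hx, ZModModule.char_nsmul_eq_zero]
  · have hxy : ⁅x, y⁆ ∈ pCentralSeries p G (n + 1) :=
      pCentralSeries_antitone n.succ.le_succ (commutatorElement_mem_pCentralSeries hx y)
    exact ⟨hxy, hf.map_commutatorElement hx hxy⟩

end IsAdditiveAlong

open CategoryTheory in
theorem exists_hom_apply_eq_of_isColimit_cokernelCofork {R : Type*} [Ring R] [TopologicalSpace R]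
    {M N : TopModuleCat R} {f : M ⟶ N} {c : Limits.CokernelCofork f} (hc : Limits.IsColimit c)
    {x : N} (hx : c.π.hom x = 0) : ∃ y, f.hom y = x := by
  have hfac : c.π ≫ hc.desc (Limits.CokernelCofork.ofπ _ (TopModuleCat.comp_cokerπ f)) =
      TopModuleCat.cokerπ f :=
    hc.fac _ Limits.WalkingParallelPair.one
  have hx' : (TopModuleCat.cokerπ f).hom x = 0 :=
    (ConcreteCategory.congr_hom hfac x).symm.trans
      ((congrArg (hc.desc _).hom hx).trans (map_zero (hc.desc _).hom))
  rwa [TopModuleCat.hom_cokerπ, Submodule.mkQ_apply, Submodule.Quotient.mk_eq_zero] at hx'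

namespace ModPCohomology

section Cochains

variable {p : ℕ} {G : Type u} [Group G] [TopologicalSpace G] [IsTopologicalGroup G]

theorem exists_cochain_eq_d_of_cls_eq_zero {n : ℕ} {z : Z p G (n + 1)} (hz : cls (n + 1) z = 0) :
    ∃ f : (cochains p G).X n, cochain z = ((cochains p G).d n (n + 1)).hom f := by
  obtain ⟨f, rfl⟩ := exists_hom_apply_eq_of_isColimit_cokernelCofork
    ((cochains p G).homologyIsCokernel n (n + 1) (by simp)) hz
  exact ⟨f, CategoryTheory.ConcreteCategory.congr_hom
    ((cochains p G).toCycles_i n (n + 1)) f⟩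

theorem ext₁ {f f' : (cochains p G).X 1} (h : ∀ x y, val₁ f x y = val₁ f' x y) : f = f' :=
  Subtype.ext (ContinuousMap.ext fun x => ContinuousMap.ext (h x))

theorem val₁_eq_val₁_one (f : (cochains p G).X 1) (x y : G) :
    val₁ f x y = val₁ f 1 (x⁻¹ * y) := by
  rw [← val₁_inv f x⁻¹ x y, inv_mul_cancel]

theorem val₁_self_mul (f : (cochains p G).X 1) (x y : G) : val₁ f x (x * y) = val₁ f 1 y := by
  rw [val₁_eq_val₁_one, inv_mul_cancel_left]

theorem isAdditiveAlong_top (z : Z p G 1) : IsAdditiveAlong ⊤ (val₁ (cochain z) 1) where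
  map_mul_left k _ x := by rw [cocycle₁ z 1 k, val₁_self_mul]
  map_mul_right k _ x := by rw [cocycle₁ z 1 x, val₁_self_mul]

theorem val₁_eq_zero_of_inv_mul_mem (z : Z p G 1) {x y : G}
    (h : x⁻¹ * y ∈ pCentralSeries p G 2) : val₁ (cochain z) x y = 0 := by
  rw [val₁_eq_val₁_one]
  exact ((isAdditiveAlong_top z).pCentralSeries_le_ker (n := 0) (map_continuous _) h).2

/-- The homogeneous 2-cocycles `z` such that `z (x, y, w) = 0` as soon as `x⁻¹ y ∈ K` or
`y⁻¹ w ∈ K`. The corresponding inhomogeneous cocycle `(s, t) ↦ z (1, s, s t)` vanishes as soon as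
one of its arguments lies in `K`. -/
noncomputable def cocyclesVanishingAlong (K : Subgroup G) : Submodule (ZMod p) (Z p G 2) where
  carrier := {z | ∀ x y w, x⁻¹ * y ∈ K ∨ y⁻¹ * w ∈ K → val₂ (cochain z) x y w = 0}
  zero_mem' x y w _ := by
    rw [show cochain (0 : Z p G 2) = 0 from map_zero _]
    rfl
  add_mem' hz hz' x y w h := by
    rw [cochain_add, val₂_add, hz x y w h, hz' x y w h, add_zero]
  smul_mem' c z hz x y w h := by
    rw [cochain_smul, val₂_smul, hz x y w h, smul_zero]

theorem cupZ_mem_cocyclesVanishingAlong [CompactSpace G] (z z' : Z p G 1) :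
    cupZ z z' ∈ cocyclesVanishingAlong (p := p) (pCentralSeries p G 2) := by
  rintro x y w (h | h)
  · rw [val₂_cupZ, val₁_eq_zero_of_inv_mul_mem z h, zero_mul]
  · rw [val₂_cupZ, val₁_eq_zero_of_inv_mul_mem z' h, mul_zero]

theorem dec_le_map_cocyclesVanishingAlong [CompactSpace G] :
    dec p G ≤ (cocyclesVanishingAlong (pCentralSeries p G 2)).map (cls 2) := by
  refine Submodule.span_le.2 ?_
  rintro _ ⟨a, b, rfl⟩
  exact ⟨cupZ (rep₁ a) (rep₁ b), cupZ_mem_cocyclesVanishingAlong _ _, rfl⟩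

theorem isAdditiveAlong_of_cochain_eq_d {K : Subgroup G} {z : Z p G 2} {f : (cochains p G).X 1}
    (hz : z ∈ cocyclesVanishingAlong K) (hf : cochain z = ((cochains p G).d 1 2).hom f) :
    IsAdditiveAlong K (val₁ f 1) := by
  have hd : ∀ x y, val₂ (cochain z) 1 x (x * y) = val₁ f 1 y - (val₁ f 1 (x * y) - val₁ f 1 x) :=
    fun x y => by rw [hf, d₁_apply, val₁_self_mul]
  constructor
  · intro k hk x
    have h := hd k x
    rw [hz 1 k (k * x) (.inl (by simpa using hk))] at h
    linear_combination h
  · intro k hk x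
    have h := hd x k
    rw [hz 1 x (x * k) (.inr (by simpa using hk))] at h
    linear_combination h

end Cochains

section Inflation

variable {p : ℕ} {D N : Type u} [Group D] [TopologicalSpace D] [IsTopologicalGroup D]
  [Group N] [TopologicalSpace N] [IsTopologicalGroup N] {β : D →ₜ* N}

theorem pullZ_mem_cocyclesVanishingAlong {K : Subgroup D} {L : Subgroup N}
    (hKL : K ≤ L.comap (β : D →* N)) {z : Z p N 2} (hz : z ∈ cocyclesVanishingAlong L) :
    pullZ β 2 z ∈ cocyclesVanishingAlong K := by
  intro x y w h
  rw [val₂_pullZ]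
  refine hz _ _ _ (h.imp (fun h => ?_) (fun h => ?_))
  all_goals
    rw [← map_inv, ← map_mul]
    exact hKL h

theorem exists_val₁_map_eq (hβ : Topology.IsQuotientMap β) {f : (cochains p D).X 1}
    (hf : Function.FactorsThrough (val₁ f 1) β) :
    ∃ f' : (cochains p N).X 1, ∀ x y, val₁ f' (β x) (β y) = val₁ f x y := by
  let h : C(N, Fp.{u} p) := Topology.IsQuotientMap.lift (f := (β : C(D, N))) hβ (val₁ f 1) hf
  have hh : ∀ x, h (β x) = val₁ f 1 x :=
    DFunLike.congr_fun (Topology.IsQuotientMap.lift_comp (f := (β : C(D, N))) hβ (val₁ f 1) hf)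
  refine ⟨mk₁ (fun x y => h (x⁻¹ * y)) (by fun_prop) fun g x y => ?_, fun x y => ?_⟩
  · rw [mul_inv_rev, mul_assoc, inv_mul_cancel_left]
  · change h ((β x)⁻¹ * β y) = _
    rw [← map_inv, ← map_mul, hh, ← val₁_eq_val₁_one]

theorem exists_val₁_map_eq_of_isAdditiveAlong (hβ : Topology.IsQuotientMap β) {n : ℕ}
    (hker : (β : D →* N).ker ≤ pCentralSeries p D (n + 2)) {f : (cochains p D).X 1}
    (hf : IsAdditiveAlong (pCentralSeries p D (n + 1)) (val₁ f 1)) :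
    ∃ f' : (cochains p N).X 1, ∀ x y, val₁ f' (β x) (β y) = val₁ f x y :=
  exists_val₁_map_eq hβ
    (hf.factorsThrough (hker.trans (hf.pCentralSeries_le_ker (map_continuous _))))

theorem pull_one_surjective (hβ : Topology.IsQuotientMap β)
    (hker : (β : D →* N).ker ≤ pCentralSeries p D 2) :
    Function.Surjective (pull (p := p) β 1) := by
  intro a
  obtain ⟨f', hf'⟩ := exists_val₁_map_eq_of_isAdditiveAlong hβ (n := 0) hker
    (isAdditiveAlong_top (rep₁ a))
  have hd : ((cochains p N).d 1 2).hom f' = 0 := by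
    refine ext₂ (hβ.surjective.forall₃.2 fun x y w => ?_)
    rw [d₁_apply, hf', hf', hf', cocycle₁ _ x y w, add_sub_cancel_left, sub_self]
    rfl
  have hpull : pullZ β 1 (mkZ f' hd) = rep₁ a :=
    cochain_injective (ext₁ fun x y => by rw [val₁_pullZ, cochain_mkZ, hf'])
  exact ⟨cls 1 (mkZ f' hd), by rw [pull_cls, hpull, cls_rep₁]⟩

variable [CompactSpace N]

theorem eq_zero_of_mem_dec_of_pull_eq_zero (hβ : Topology.IsQuotientMap β)
    (hker : (β : D →* N).ker ≤ pCentralSeries p D 3) {c : H p N 2} (hc : c ∈ dec p N)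
    (hc₀ : pull β 2 c = 0) : c = 0 := by
  obtain ⟨z, hz, rfl⟩ := dec_le_map_cocyclesVanishingAlong hc
  rw [pull_cls] at hc₀
  obtain ⟨f, hf⟩ := exists_cochain_eq_d_of_cls_eq_zero hc₀
  have hadd : IsAdditiveAlong (pCentralSeries p D 2) (val₁ f 1) :=
    isAdditiveAlong_of_cochain_eq_d
      (pullZ_mem_cocyclesVanishingAlong (pCentralSeries_le_comap β 2) hz) hf
  obtain ⟨f', hf'⟩ := exists_val₁_map_eq_of_isAdditiveAlong hβ hker hadd
  refine cls_eq_zero z f' (ext₂ (hβ.surjective.forall₃.2 fun x y w => ?_))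
  rw [← val₂_pullZ, hf, d₁_apply, d₁_apply, hf', hf', hf']

variable [CompactSpace D]

theorem map_pull_dec (hβ : Function.Surjective (pull (p := p) β 1)) :
    (dec p N).map (pull β 2) = dec p D := by
  refine le_antisymm (Submodule.map_le_iff_le_comap.2 (dec_le_comap_pull β))
    (Submodule.span_le.2 ?_)
  rintro _ ⟨a, b, rfl⟩
  obtain ⟨a, rfl⟩ := hβ a
  obtain ⟨b, rfl⟩ := hβ b
  exact ⟨cup a b, Submodule.subset_span ⟨a, b, rfl⟩, pull_cup β a b⟩

variable (β) in
/-- Inflation `H^2(N, 𝔽_p)^{dec} → H^2(D, 𝔽_p)^{dec}` of decomposable classes along `β : D → N`. -/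
noncomputable def pullDec : dec p N →ₗ[ZMod p] dec p D :=
  (pull β 2).restrict (dec_le_comap_pull β)

theorem pullDec_bijective (hβ : Topology.IsQuotientMap β)
    (hker : (β : D →* N).ker ≤ pCentralSeries p D 3) :
    Function.Bijective (pullDec (p := p) β) := by
  constructor
  · refine (injective_iff_map_eq_zero _).2 fun c hc => Subtype.ext ?_
    exact eq_zero_of_mem_dec_of_pull_eq_zero hβ hker c.2 congr(($hc).1)
  · rintro ⟨c, hc⟩
    rw [← map_pull_dec (pull_one_surjective hβ
      (hker.trans (pCentralSeries_antitone (Nat.le_succ 2))))] at hc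
    obtain ⟨c', hc', rfl⟩ := hc
    exact ⟨⟨c', hc'⟩, rfl⟩

end Inflation

section Equivariance

variable {p : ℕ} {Γ H : Type u} [Group Γ] [TopologicalSpace Γ] [Group H] [TopologicalSpace H]
  {Δ : Subgroup Γ} {N : Subgroup H} (α : Γ →ₜ* H)

/-- The continuous homomorphism `Δ → N` that `α : Γ → H` restricts to if `α(Δ) ⊆ N`. -/
def restrictHom (h : Δ ≤ N.comap (α : Γ →* H)) : Δ →ₜ* N where
  toMonoidHom := (α : Γ →* H).restrict h
  continuous_toFun := ((map_continuous α).comp continuous_subtype_val).subtype_mk _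

theorem restrictHom_surjective (h : Δ.map (α : Γ →* H) = N) :
    Function.Surjective (restrictHom α (Subgroup.map_le_iff_le_comap.1 h.le)) := by
  subst h
  exact (α : Γ →* H).subgroupMap_surjective Δ

theorem ker_restrictHom_le (h : Δ ≤ N.comap (α : Γ →* H)) {K : Subgroup Δ}
    (hK : (α : Γ →* H).ker ≤ K.map Δ.subtype) : (restrictHom α h : Δ →* N).ker ≤ K := by
  intro x hx
  obtain ⟨y, hy, hyx⟩ := hK (x := (x : Γ)) congr(($hx).1)
  rwa [← Subtype.ext hyx]

variable [IsTopologicalGroup Γ] [IsTopologicalGroup H] [Δ.Normal] [N.Normal]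

theorem conjInv_comp_restrictHom (h : Δ ≤ N.comap (α : Γ →* H)) (g : Γ) :
    (conjInv N (α g)).comp (restrictHom α h) = (restrictHom α h).comp (conjInv Δ g) := by
  ext x
  change (conjInv N (α g) (restrictHom α h x) : H) = α (conjInv Δ g x : Γ)
  rw [coe_conjInv, coe_conjInv, map_mul, map_mul, map_inv]
  rfl

theorem pullDec_conjRepDec [CompactSpace Δ] [CompactSpace N]
    (h : Δ ≤ N.comap (α : Γ →* H)) (g : Γ) (c : dec p N) :
    pullDec (restrictHom α h) (conjRepDec p N (α g) c) =
      conjRepDec p Δ g (pullDec (restrictHom α h) c) := by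
  apply Subtype.ext
  change pull (restrictHom α h) 2 (pull (conjInv N (α g)) 2 c.1) =
    pull (conjInv Δ g) 2 (pull (restrictHom α h) 2 c.1)
  rw [← LinearMap.comp_apply, ← pull_comp, conjInv_comp_restrictHom, pull_comp,
    LinearMap.comp_apply]

end Equivariance

end ModPCohomology

open ModPCohomology in
theorem mainTheorem11_general (p : ℕ)
    {Γ H : Type u} [Group Γ] [TopologicalSpace Γ] [IsTopologicalGroup Γ]
    [Group H] [TopologicalSpace H] [IsTopologicalGroup H]
    (Δ : Subgroup Γ) (N : Subgroup H) [Δ.Normal] [N.Normal]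
    [CompactSpace Δ] [CompactSpace N] [T2Space N]
    (α : Γ →ₜ* H) (hα : Function.Surjective α)
    (hαΔ : Δ.map (α : Γ →* H) = N)
    (hker : (α : Γ →* H).ker ≤ (pCentralSeries p Δ 3).map Δ.subtype) :
    Nonempty (Representation.Equiv (decRep p Δ)
      ((decRep p N).comp
        (quotientIso (α : Γ →* H) hα hαΔ (hker.trans (Subgroup.map_subtype_le _)) :
          Γ ⧸ Δ →* H ⧸ N))) := by
  let β : Δ →ₜ* N := restrictHom α (Subgroup.map_le_iff_le_comap.1 hαΔ.le)
  have hβ : Topology.IsQuotientMap β :=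
    .of_surjective_continuous (restrictHom_surjective α hαΔ) (map_continuous β)
  let e : dec p N ≃ₗ[ZMod p] dec p Δ :=
    .ofBijective (pullDec β) (pullDec_bijective hβ (ker_restrictHom_le α _ hker))
  refine ⟨.symm (.mk e fun g => ?_)⟩
  obtain ⟨g, rfl⟩ := QuotientGroup.mk_surjective g
  exact LinearMap.ext (pullDec_conjRepDec α _ g)

theorem mainTheorem11 (p : ℕ) [Fact p.Prime]
    {Γ H : Type u} [Group Γ] [TopologicalSpace Γ] [IsTopologicalGroup Γ]
    [Group H] [TopologicalSpace H] [IsTopologicalGroup H]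
    (hΓ : IsProP p Γ) (hH : IsProP p H)
    (Δ : Subgroup Γ) (N : Subgroup H) (hΔ : IsMaximalClosed Δ) (hN : IsMaximalClosed N)
    (α : Γ →ₜ* H) (hα : Function.Surjective α)
    (hαΔ : Δ.map (α : Γ →* H) = N)
    (hker : (α : Γ →* H).ker ≤ (pCentralSeries p Δ 3).map Δ.subtype) :
    haveI : Δ.Normal := hΔ.normal hΓ
    haveI : N.Normal := hN.normal hH
    haveI : CompactSpace Δ := hΔ.compactSpace hΓ
    haveI : CompactSpace N := hN.compactSpace hH
    Nonempty (Representation.Equiv (ModPCohomology.decRep p Δ)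
      ((ModPCohomology.decRep p N).comp
        (quotientIso (α : Γ →* H) hα hαΔ (hker.trans (Subgroup.map_subtype_le _)) :
          Γ ⧸ Δ →* H ⧸ N))) := by
  have := hΔ.normal hΓ
  have := hN.normal hH
  have := hΔ.compactSpace hΓ
  have := hN.compactSpace hH
  have := hH.totallyDisconnectedSpace
  exact mainTheorem11_general p Δ N α hα hαΔ hker
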